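/- Let $E\subset\mathbb C$ be a set on which $\operatorname{Re} s$ is bounded above and $|\operatorname{Im} s|$ is bounded. Let $F$ be an entire function for which there are constants $a,b,c,a',b',c'>0$ such that $$|F(s)|\le c\,e^{a\operatorname{Re}s}\,(1+|\operatorname{Im}s|^{b})\quad\text{whenever }\operatorname{Re}s\le x_0,$$ for some $x_0\in\mathbb R$, and $$|F(s)|\le c'\,(1+e^{a'\operatorname{Re}s})\,(1+|\operatorname{Im}s|^{b'})\quad\text{for all }s\in\mathbb C.$$ Then there is $\sigma_0>0$ such that for every $\sigma\in(0,\sigma_0)$ there exist $C>0$, $K>0$ and, for every integer $n\ge 0$, a rational function of type $(n-1,n)$ (numerator of degree at most $n-1$, denominator of degree at most $n$) of the form $$r_n(s)=p_n\!\left(\frac1{s-\sigma n}\right),$$ where $p_n$ is a polynomial of degree at most $n$ with $p_n(0)=0$, and $\sigma n\notin E$ unless $p_n=0$, such that $$\sup_{s\in E}|F(s)-r_n(s)|\le K\,e^{-Cn}\quad\text{for all }n\ge 0.$$ Moreover, for all sufficiently large $n$, the degree of $p_n$ is exactly $n$, $\sigma n\notin E$, and $$\sup_{s\in E}|F(s)-r_n(s)|\le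 e^{-Cn}.$$ -/

import Mathlib

open Polynomial Filter

/-- `r` is a rational function of type `(m, n)`: it is a quotient `P / Q` (away from the zeros
of `Q`) of polynomials with `deg P ≤ m` and `deg Q ≤ n`, `Q ≠ 0`. The indices are integers so that
type `(n - 1, n)` makes sense at `n = 0`, where a polynomial of degree at most `-1` is zero. -/
def IsRationalOfType (m n : ℤ) (r : ℂ → ℂ) : Prop :=
  ∃ P Q : ℂ[X], Q ≠ 0 ∧ (P ≠ 0 → (P.natDegree : ℤ) ≤ m) ∧ (Q.natDegree : ℤ) ≤ n ∧
    ∀ s : ℂ, Q.eval s ≠ 0 → r s = P.eval s / Q.eval s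

/-- The function `s ↦ p (1 / (s - σ n))`, whose only possible pole is `s = σ n`. -/
noncomputable def confluentRational (σ : ℝ) (n : ℕ) (p : ℂ[X]) (s : ℂ) : ℂ :=
  p.eval (1 / (s - (σ : ℂ) * (n : ℂ)))

/-!
The substitution `s = -λ v²` with `λ = σ n` turns `F` into the even entire function
`G v = F (-λ v²)`. The set `E` is covered by the image of an arbitrarily thin strip `|Im v| ≤ δ`
once `n` is large. Decay of `F` to the left becomes Gaussian decay of `G` along horizontal lines,
so Cauchy's formula holds on a strip of fixed width `η`; evenness folds its two edges into the
single line `Im v = η` and the kernel into `2v / (v₀² - v²)` (`integral_cauchy_strip_of_even`).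

Since `1 / (s - λ)` is a multiple of `y = 1 / (1 + v₀²)`, polynomials in `y` of degree at most `n`
without constant term are exactly the admissible rational functions. With `Y = 1 / (1 + v²)` the
kernel is `2v · yY / (Y - y)`. Interpolating `1 / (Y - y)` at the zeros of the Chebyshev polynomial
`q` of degree `n` for `[0, 1]` (the range of `y` for real `v₀`) gives a polynomial of degree at most
`n - 1` in `y`, with the Hermite remainder `q(y) / q(Y)` times the kernel
(`exists_polynomial_approx_of_even`).

The map `w = (1 + iv) / (1 - iv)` uniformizes `q`: `2 q = wⁿ + w⁻ⁿ`. Hence `q(y)` grows at most like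
`exp (8 δ n)`, whereas `q(Y)` is at least of order `exp (2 η n / (4 + (Re v)²))` up to powers
of `Re v`. On the line, `F` contributes at most `exp (O(η²) σ n)` where `|Re v| ≤ 1`, which the
Chebyshev gain of order `η n` beats once `η` is small. Where `|Re v| ≥ 1` the gain degenerates, but
there `F` itself is exponentially small in `n` (`exists_polynomial_approx_exp`). The parameter `η`
adapts to `σ`, so every `σ > 0` is admissible. Finally the degree is made exactly `n` by adding an
exponentially small multiple of the top power.
-/

/-! ### Cauchy's formula on a strip -/

open MeasureTheory Complex in
/-- The difference of the Cauchy kernel on the two edges of a horizontal strip has an explicit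
primitive, built from `arctan` and `log`; hence its total mass is `2πi`. -/
theorem tendsto_integral_cauchyKernel_strip {η : ℝ} {v₀ : ℂ} (hv : |v₀.im| < η) :
    Tendsto (fun R : ℝ => ∫ x in (-R)..R,
      (1 / ((x : ℂ) - η * I - v₀) - 1 / ((x : ℂ) + η * I - v₀))) atTop
      (nhds (2 * Real.pi * I)) := by
  obtain ⟨hlo, hhi⟩ := abs_lt.1 hv
  set t := v₀.re with ht
  set h₁ := η + v₀.im with hh₁
  set h₂ := η - v₀.im with hh₂
  have p₁ : 0 < h₁ := by linarith
  have p₂ : 0 < h₂ := by linarith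
  have n₁ : ∀ x : ℝ, (x : ℂ) - η * I - v₀ = ((x - t : ℝ) : ℂ) - h₁ * I := by
    intro x; apply Complex.ext <;> simp [ht, hh₁]; ring
  have n₂ : ∀ x : ℝ, (x : ℂ) + η * I - v₀ = ((x - t : ℝ) : ℂ) + h₂ * I := by
    intro x; apply Complex.ext <;> simp [ht, hh₂]
  have z₁ : ∀ x : ℝ, (((x - t : ℝ) : ℂ) - h₁ * I) ≠ 0 := by
    intro x h
    have := congrArg Complex.im h
    simp at this; linarith
  have z₂ : ∀ x : ℝ, (((x - t : ℝ) : ℂ) + h₂ * I) ≠ 0 := by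
    intro x h
    have := congrArg Complex.im h
    simp at this; linarith
  let A : ℝ → ℝ := fun x => Real.arctan ((x - t) / h₁) + Real.arctan ((x - t) / h₂)
  let L : ℝ → ℝ := fun x => 1 / 2 * (Real.log ((x - t) ^ 2 + h₁ ^ 2) -
    Real.log ((x - t) ^ 2 + h₂ ^ 2))
  have dA : ∀ x, HasDerivAt A (h₁ / ((x - t) ^ 2 + h₁ ^ 2) + h₂ / ((x - t) ^ 2 + h₂ ^ 2)) x := by
    intro x
    have e : ∀ h : ℝ, 0 < h →
        HasDerivAt (fun x => Real.arctan ((x - t) / h)) (h / ((x - t) ^ 2 + h ^ 2)) x := by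
      intro h hp
      have := (((hasDerivAt_id x).sub_const t).div_const h).arctan
      refine this.congr_deriv ?_
      simp only [id]
      field_simp
      ring
    exact (e h₁ p₁).add (e h₂ p₂)
  have dL : ∀ x, HasDerivAt L ((x - t) / ((x - t) ^ 2 + h₁ ^ 2)
      - (x - t) / ((x - t) ^ 2 + h₂ ^ 2)) x := by
    intro x
    have e : ∀ h : ℝ, 0 < h →
        HasDerivAt (fun x => Real.log ((x - t) ^ 2 + h ^ 2))
          (2 * (x - t) / ((x - t) ^ 2 + h ^ 2)) x := by
      intro h hp
      have hpos : (x - t) ^ 2 + h ^ 2 ≠ 0 := by positivity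
      have := ((((hasDerivAt_id x).sub_const t).fun_pow 2).add_const (h ^ 2)).log hpos
      refine this.congr_deriv ?_
      simp
    refine (((e h₁ p₁).sub (e h₂ p₂)).const_mul (1 / 2)).congr_deriv ?_
    ring
  have dΦ : ∀ x : ℝ, HasDerivAt (fun x : ℝ => (L x : ℂ) + I * (A x : ℂ))
      (1 / ((x : ℂ) - η * I - v₀) - 1 / ((x : ℂ) + η * I - v₀)) x := by
    intro x
    refine ((dL x).ofReal_comp.add ((dA x).ofReal_comp.const_mul I)).congr_deriv ?_
    rw [n₁, n₂]
    have q₁ : (((x - t : ℝ) : ℂ) ^ 2 + (h₁ : ℂ) ^ 2) =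
        (((x - t : ℝ) : ℂ) - h₁ * I) * (((x - t : ℝ) : ℂ) + h₁ * I) := by
      linear_combination ((h₁ : ℂ) ^ 2) * I_sq
    have q₂ : (((x - t : ℝ) : ℂ) ^ 2 + (h₂ : ℂ) ^ 2) =
        (((x - t : ℝ) : ℂ) - h₂ * I) * (((x - t : ℝ) : ℂ) + h₂ * I) := by
      linear_combination ((h₂ : ℂ) ^ 2) * I_sq
    have z₁' : (((x - t : ℝ) : ℂ) + h₁ * I) ≠ 0 := by
      intro h
      have := congrArg Complex.im h
      simp at this; linarith
    have z₂' : (((x - t : ℝ) : ℂ) - h₂ * I) ≠ 0 := by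
      intro h
      have := congrArg Complex.im h
      simp at this; linarith
    have w₁ : 1 / (((x - t : ℝ) : ℂ) - h₁ * I) = (((x - t : ℝ) : ℂ) + h₁ * I) /
        (((x - t : ℝ) : ℂ) ^ 2 + (h₁ : ℂ) ^ 2) := by
      rw [q₁]; field_simp [z₁ x, z₁']
    have w₂ : 1 / (((x - t : ℝ) : ℂ) + h₂ * I) = (((x - t : ℝ) : ℂ) - h₂ * I) /
        (((x - t : ℝ) : ℂ) ^ 2 + (h₂ : ℂ) ^ 2) := by
      rw [q₂]; field_simp [z₂ x, z₂']
    rw [w₁, w₂]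
    simp only [Complex.ofReal_sub, Complex.ofReal_add, Complex.ofReal_div, Complex.ofReal_pow]
    ring
  have cont : Continuous (fun x : ℝ =>
      (1 / ((x : ℂ) - η * I - v₀) - 1 / ((x : ℂ) + η * I - v₀))) := by
    apply Continuous.sub
    · exact continuous_const.div (by fun_prop) (fun x => by rw [n₁]; exact z₁ x)
    · exact continuous_const.div (by fun_prop) (fun x => by rw [n₂]; exact z₂ x)
  have hFTC : ∀ R : ℝ, ∫ x in (-R)..R,
      (1 / ((x : ℂ) - η * I - v₀) - 1 / ((x : ℂ) + η * I - v₀)) =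
      ((L R : ℂ) + I * (A R : ℂ)) - ((L (-R) : ℂ) + I * (A (-R) : ℂ)) := fun R =>
    intervalIntegral.integral_eq_sub_of_hasDerivAt (fun x _ => dΦ x) (cont.intervalIntegrable _ _)
  simp_rw [hFTC]
  have shT : Tendsto (fun x : ℝ => x - t) atTop atTop := tendsto_atTop_add_const_right _ _ tendsto_id
  have shB : Tendsto (fun x : ℝ => x - t) atBot atBot := tendsto_atBot_add_const_right _ _ tendsto_id
  have AT : Tendsto A atTop (nhds (Real.pi / 2 + Real.pi / 2)) := by
    refine Tendsto.add ?_ ?_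
    · exact (Real.tendsto_arctan_atTop.mono_right nhdsWithin_le_nhds).comp
        (shT.atTop_div_const p₁)
    · exact (Real.tendsto_arctan_atTop.mono_right nhdsWithin_le_nhds).comp
        (shT.atTop_div_const p₂)
  have AB : Tendsto A atBot (nhds (-(Real.pi / 2) + -(Real.pi / 2))) := by
    refine Tendsto.add ?_ ?_
    · exact (Real.tendsto_arctan_atBot.mono_right nhdsWithin_le_nhds).comp
        (shB.atBot_div_const p₁)
    · exact (Real.tendsto_arctan_atBot.mono_right nhdsWithin_le_nhds).comp
        (shB.atBot_div_const p₂)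
  have Leq : ∀ x, L x = 1 / 2 * Real.log (1 + (h₁ ^ 2 - h₂ ^ 2) / ((x - t) ^ 2 + h₂ ^ 2)) := by
    intro x
    have e₁ : (x - t) ^ 2 + h₁ ^ 2 ≠ 0 := by positivity
    have e₂ : (x - t) ^ 2 + h₂ ^ 2 ≠ 0 := by positivity
    have : 1 + (h₁ ^ 2 - h₂ ^ 2) / ((x - t) ^ 2 + h₂ ^ 2) =
      ((x - t) ^ 2 + h₁ ^ 2) / ((x - t) ^ 2 + h₂ ^ 2) := by field_simp; ring
    rw [this, Real.log_div e₁ e₂]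
  have Llim : ∀ l : Filter ℝ, Tendsto (fun x : ℝ => (x - t) ^ 2) l atTop → Tendsto L l (nhds 0) := by
    intro l hl
    have h : Tendsto (fun x : ℝ => 1 + (h₁ ^ 2 - h₂ ^ 2) / ((x - t) ^ 2 + h₂ ^ 2)) l
        (nhds (1 + 0)) :=
      tendsto_const_nhds.add
        (tendsto_const_nhds.div_atTop (tendsto_atTop_add_const_right _ _ hl))
    rw [add_zero] at h
    have := (h.log one_ne_zero).const_mul (1 / 2)
    rw [Real.log_one, mul_zero] at this
    exact this.congr (fun x => (Leq x).symm)
  have LT := Llim atTop ((tendsto_pow_atTop two_ne_zero).comp shT)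
  have LB := Llim atBot (by
    have := (tendsto_pow_atTop (α := ℝ) two_ne_zero).comp (tendsto_neg_atBot_atTop.comp shB)
    simpa only [Function.comp_def, neg_sq] using this)
  have final := ((Complex.continuous_ofReal.tendsto _).comp LT |>.add
    (((Complex.continuous_ofReal.tendsto _).comp AT).const_mul I)).sub
    (((Complex.continuous_ofReal.tendsto _).comp (LB.comp tendsto_neg_atTop_atBot)).add
    (((Complex.continuous_ofReal.tendsto _).comp (AB.comp tendsto_neg_atTop_atBot)).const_mul I))
  have e : (((0 : ℝ) : ℂ) + I * ((Real.pi / 2 + Real.pi / 2 : ℝ) : ℂ)) -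
      (((0 : ℝ) : ℂ) + I * ((-(Real.pi / 2) + -(Real.pi / 2) : ℝ) : ℂ)) = 2 * Real.pi * I := by
    push_cast
    ring
  rw [e] at final
  exact final

open MeasureTheory Complex in
/-- Cauchy's integral formula on a horizontal strip, for a function that is bounded on the strip
and integrable on its two edges. -/
theorem integral_cauchy_strip {G : ℂ → ℂ} (hG : Differentiable ℂ G) {η B : ℝ} {v₀ : ℂ}
    (hv : |v₀.im| < η) (hB : ∀ v : ℂ, |v.im| ≤ η → ‖G v‖ ≤ B)
    (hint₁ : Integrable (fun x : ℝ => G (x - η * I)))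
    (hint₂ : Integrable (fun x : ℝ => G (x + η * I))) :
    ∫ x : ℝ, (G (x - η * I) / ((x : ℂ) - η * I - v₀) - G (x + η * I) / ((x : ℂ) + η * I - v₀)) =
      2 * Real.pi * I * G v₀ := by
  have hη : 0 < η := (abs_nonneg _).trans_lt hv
  obtain ⟨hlo, hhi⟩ := abs_lt.1 hv
  have im₁ : ∀ x : ℝ, ((x : ℂ) - η * I - v₀).im = -(η + v₀.im) := by intro x; simp; ring
  have im₂ : ∀ x : ℝ, ((x : ℂ) + η * I - v₀).im = η - v₀.im := by intro x; simp
  have z₁ : ∀ x : ℝ, (x : ℂ) - η * I - v₀ ≠ 0 := by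
    intro x h; have := im₁ x; rw [h] at this; simp at this; linarith
  have z₂ : ∀ x : ℝ, (x : ℂ) + η * I - v₀ ≠ 0 := by
    intro x h; have := im₂ x; rw [h] at this; simp at this; linarith
  have b₁ : ∀ x : ℝ, ‖((x : ℂ) - η * I - v₀)⁻¹‖ ≤ (η + v₀.im)⁻¹ := by
    intro x
    rw [norm_inv]
    refine inv_anti₀ (by linarith) ?_
    have := abs_im_le_norm ((x : ℂ) - η * I - v₀)
    rw [im₁, abs_neg, abs_of_pos (by linarith)] at this
    exact this
  have b₂ : ∀ x : ℝ, ‖((x : ℂ) + η * I - v₀)⁻¹‖ ≤ (η - v₀.im)⁻¹ := by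
    intro x
    rw [norm_inv]
    refine inv_anti₀ (by linarith) ?_
    have := abs_im_le_norm ((x : ℂ) + η * I - v₀)
    rw [im₂, abs_of_pos (by linarith)] at this
    exact this
  have c₁ : Continuous fun x : ℝ => ((x : ℂ) - η * I - v₀)⁻¹ :=
    Continuous.inv₀ (by fun_prop) z₁
  have c₂ : Continuous fun x : ℝ => ((x : ℂ) + η * I - v₀)⁻¹ :=
    Continuous.inv₀ (by fun_prop) z₂
  have i₁ : Integrable fun x : ℝ => G (x - η * I) / ((x : ℂ) - η * I - v₀) := by
    simp_rw [div_eq_mul_inv]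
    exact hint₁.mul_bdd c₁.aestronglyMeasurable (Eventually.of_forall b₁)
  have i₂ : Integrable fun x : ℝ => G (x + η * I) / ((x : ℂ) + η * I - v₀) := by
    simp_rw [div_eq_mul_inv]
    exact hint₂.mul_bdd c₂.aestronglyMeasurable (Eventually.of_forall b₂)
  have T₁ : Tendsto (fun R : ℝ => ∫ x in (-R)..R, (G (x - η * I) / ((x : ℂ) - η * I - v₀) -
      G (x + η * I) / ((x : ℂ) + η * I - v₀))) atTop (nhds (∫ x : ℝ,
      (G (x - η * I) / ((x : ℂ) - η * I - v₀) - G (x + η * I) / ((x : ℂ) + η * I - v₀)))) :=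
    intervalIntegral_tendsto_integral (i₁.sub i₂) tendsto_neg_atTop_atBot tendsto_id
  have T₂ := (tendsto_integral_cauchyKernel_strip hv).mul_const (G v₀)
  set H := dslope G v₀ with hH
  have dH : Differentiable ℂ H := by
    intro z
    have := (Complex.differentiableOn_dslope (s := Set.univ) (c := v₀) univ_mem).2
      hG.differentiableOn
    exact this.differentiableAt univ_mem
  have Hval : ∀ z, z - v₀ ≠ 0 → H z = G z / (z - v₀) - G v₀ * (1 / (z - v₀)) := by
    intro z hz
    rw [hH, dslope_of_ne _ (sub_ne_zero.1 hz), slope_def_field]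
    ring
  have hB0 : 0 ≤ B := (norm_nonneg _).trans (hB v₀ hv.le)
  -- the two vertical sides contribute `O(1 / R)`
  have side : ∀ ε : ℝ, |ε| = 1 → Tendsto (fun R : ℝ => ∫ y in (-η)..η, H ((ε * R : ℝ) + y * I))
      atTop (nhds 0) := by
    intro ε hε
    have bound : ∀ᶠ R : ℝ in atTop, ‖∫ y in (-η)..η, H ((ε * R : ℝ) + y * I)‖ ≤
        (2 * B * |η - -η|) / (R - |v₀.re|) := by
      filter_upwards [eventually_gt_atTop |v₀.re|] with R hR
      have hR0 : 0 < R := (abs_nonneg _).trans_lt hR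
      have : ∀ y ∈ Set.uIoc (-η) η, ‖H ((ε * R : ℝ) + y * I)‖ ≤ 2 * B / (R - |v₀.re|) := by
        intro y hy
        rw [Set.uIoc_of_le (by linarith)] at hy
        set z : ℂ := (ε * R : ℝ) + y * I with hz
        have hzim : z.im = y := by simp [hz]
        have hzre : z.re = ε * R := by simp [hz]
        have hd : R - |v₀.re| ≤ ‖z - v₀‖ := by
          refine le_trans ?_ (abs_re_le_norm _)
          rw [sub_re, hzre]
          refine le_trans ?_ (abs_sub_abs_le_abs_sub _ _)
          rw [abs_mul, hε, one_mul, abs_of_pos hR0]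
        have hpos : 0 < R - |v₀.re| := by linarith
        have hne : z - v₀ ≠ 0 := norm_pos_iff.1 (hpos.trans_le hd)
        rw [hH, dslope_of_ne _ (sub_ne_zero.1 hne), slope_def_field, norm_div]
        have hGz : ‖G z - G v₀‖ ≤ 2 * B := by
          have h1 := hB z (by rw [hzim]; exact abs_le.2 ⟨hy.1.le, hy.2⟩)
          have h2 := hB v₀ hv.le
          linarith [norm_sub_le (G z) (G v₀)]
        gcongr
      refine (intervalIntegral.norm_integral_le_of_norm_le_const this).trans (le_of_eq ?_)
      ring
    refine squeeze_zero_norm' bound ?_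
    exact tendsto_const_nhds.div_atTop (tendsto_atTop_add_const_right _ _ tendsto_id)
  have T₃ := (((side 1 (by simp)).const_mul I).sub ((side (-1) (by simp)).const_mul I)).neg
  have key : ∀ R : ℝ, (∫ x in (-R)..R, (G (x - η * I) / ((x : ℂ) - η * I - v₀) -
      G (x + η * I) / ((x : ℂ) + η * I - v₀))) - (∫ x in (-R)..R,
      (1 / ((x : ℂ) - η * I - v₀) - 1 / ((x : ℂ) + η * I - v₀))) * G v₀ =
      -(I * (∫ y in (-η)..η, H ((1 * R : ℝ) + y * I)) -
        I * (∫ y in (-η)..η, H ((-1 * R : ℝ) + y * I))) := by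
    intro R
    have rect := integral_boundary_rect_eq_zero_of_differentiableOn H (⟨-R, -η⟩ : ℂ) ⟨R, η⟩
      dH.differentiableOn
    simp only [smul_eq_mul] at rect
    have hc : ∀ h : ℝ, Continuous fun x : ℝ => H ((x : ℂ) + h * I) := fun h =>
      dH.continuous.comp (by fun_prop)
    have e : (∫ x in (-R)..R, (G (x - η * I) / ((x : ℂ) - η * I - v₀) -
      G (x + η * I) / ((x : ℂ) + η * I - v₀))) - (∫ x in (-R)..R,
      (1 / ((x : ℂ) - η * I - v₀) - 1 / ((x : ℂ) + η * I - v₀))) * G v₀ =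
        (∫ x in (-R)..R, H ((x : ℂ) + (-η : ℝ) * I)) - ∫ x in (-R)..R, H ((x : ℂ) + η * I) := by
      rw [← intervalIntegral.integral_mul_const, ← intervalIntegral.integral_sub,
        ← intervalIntegral.integral_sub ((hc _).intervalIntegrable _ _)
          ((hc _).intervalIntegrable _ _)]
      · refine intervalIntegral.integral_congr fun x _ => ?_
        have e₁ : (x : ℂ) + (-η : ℝ) * I = x - η * I := by push_cast; ring
        rw [e₁, Hval _ (z₁ x), Hval _ (z₂ x)]
        ring
      · exact (i₁.sub i₂).intervalIntegrable
      · refine Continuous.intervalIntegrable ?_ _ _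
        simp_rw [one_div]
        exact (c₁.sub c₂).mul continuous_const
    rw [e]
    rw [one_mul, neg_one_mul]
    linear_combination rect
  have := tendsto_nhds_unique ((T₁.sub T₂).congr key) T₃
  simp only [mul_zero, sub_zero, neg_zero] at this
  exact sub_eq_zero.1 this

open MeasureTheory Complex in
/-- Cauchy's formula on a strip for an even function: the lower edge is reflected onto the upper
one, which turns the Cauchy kernel into `2v / (v₀² - v²)`. -/
theorem integral_cauchy_strip_of_even {G : ℂ → ℂ} (hG : Differentiable ℂ G)
    (heven : ∀ v, G (-v) = G v) {η B : ℝ} {v₀ : ℂ}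
    (hv : |v₀.im| < η) (hB : ∀ v : ℂ, |v.im| ≤ η → ‖G v‖ ≤ B)
    (hint : Integrable (fun x : ℝ => G (x + η * I))) :
    ∫ x : ℝ, G (x + η * I) * (2 * ((x : ℂ) + η * I) / (v₀ ^ 2 - ((x : ℂ) + η * I) ^ 2)) =
      2 * Real.pi * I * G v₀ := by
  obtain ⟨hlo, hhi⟩ := abs_lt.1 hv
  have refl : ∀ x : ℝ, G (((-x : ℝ) : ℂ) - η * I) = G (x + η * I) := by
    intro x; rw [← heven]; congr 1; push_cast; ring
  have hint₁ : Integrable (fun x : ℝ => G (x - η * I)) := by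
    have := hint.comp_neg
    refine this.congr (Eventually.of_forall fun x => ?_)
    simp only
    rw [← refl, neg_neg]
  have z₁ : ∀ x : ℝ, (x : ℂ) - η * I - v₀ ≠ 0 := by
    intro x h; have := congrArg Complex.im h; simp at this; linarith
  have z₂ : ∀ x : ℝ, (x : ℂ) + η * I - v₀ ≠ 0 := by
    intro x h; have := congrArg Complex.im h; simp at this; linarith
  have z₃ : ∀ x : ℝ, (x : ℂ) + η * I + v₀ ≠ 0 := by
    intro x h; have := congrArg Complex.im h; simp at this; linarith
  have b₁ : ∀ x : ℝ, ‖((x : ℂ) - η * I - v₀)⁻¹‖ ≤ (η + v₀.im)⁻¹ := by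
    intro x
    rw [norm_inv]
    refine inv_anti₀ (by linarith) ?_
    have := abs_im_le_norm ((x : ℂ) - η * I - v₀)
    have e : ((x : ℂ) - η * I - v₀).im = -(η + v₀.im) := by simp; ring
    rw [e, abs_neg, abs_of_pos (by linarith)] at this
    exact this
  have b₂ : ∀ x : ℝ, ‖((x : ℂ) + η * I - v₀)⁻¹‖ ≤ (η - v₀.im)⁻¹ := by
    intro x
    rw [norm_inv]
    refine inv_anti₀ (by linarith) ?_
    have := abs_im_le_norm ((x : ℂ) + η * I - v₀)
    have e : ((x : ℂ) + η * I - v₀).im = η - v₀.im := by simp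
    rw [e, abs_of_pos (by linarith)] at this
    exact this
  have i₁ : Integrable fun x : ℝ => G (x - η * I) / ((x : ℂ) - η * I - v₀) := by
    simp_rw [div_eq_mul_inv]
    exact hint₁.mul_bdd (Continuous.inv₀ (by fun_prop) z₁).aestronglyMeasurable
      (Eventually.of_forall b₁)
  have i₂ : Integrable fun x : ℝ => G (x + η * I) / ((x : ℂ) + η * I - v₀) := by
    simp_rw [div_eq_mul_inv]
    exact hint.mul_bdd (Continuous.inv₀ (by fun_prop) z₂).aestronglyMeasurable
      (Eventually.of_forall b₂)
  rw [← integral_cauchy_strip hG hv hB hint₁ hint, integral_sub i₁ i₂,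
    ← integral_neg_eq_self (fun x : ℝ => G (x - η * I) / ((x : ℂ) - η * I - v₀)),
    ← integral_sub i₁.comp_neg i₂]
  refine integral_congr_ae (Eventually.of_forall fun x => ?_)
  simp only
  rw [refl]
  have e₁ : (((-x : ℝ) : ℂ) - η * I - v₀) = -((x : ℂ) + η * I + v₀) := by push_cast; ring
  have e₂ : v₀ ^ 2 - ((x : ℂ) + η * I) ^ 2 =
      -(((x : ℂ) + η * I + v₀) * ((x : ℂ) + η * I - v₀)) := by ring
  rw [e₁, e₂]
  have := z₂ x
  have := z₃ x
  field_simp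
  ring

/-! ### Shifted Chebyshev polynomials -/

/-- The Chebyshev polynomial of degree `n` transplanted from `[-1, 1]` to `[0, 1]`. -/
noncomputable def shiftedChebyshev (n : ℕ) : ℂ[X] :=
  (Chebyshev.T ℂ n).comp (C 2 * X - 1)

theorem natDegree_shiftedChebyshev_le (n : ℕ) : (shiftedChebyshev n).natDegree ≤ n := by
  refine natDegree_comp_le.trans ?_
  have h₁ : (Chebyshev.T ℂ n).natDegree = n := by
    rw [Chebyshev.natDegree_T]; simp
  have h₂ : (C (2 : ℂ) * X - 1).natDegree ≤ 1 := by
    compute_degree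
  rw [h₁]
  nlinarith

/-- The substitution `y = 1 / (1 + v²)` uniformizes the shifted Chebyshev polynomials: it equals
`(w + w⁻¹) / 2` up to the shift, with `w = (1 + iv) / (1 - iv)`. -/
theorem eval_shiftedChebyshev (n : ℕ) {v : ℂ} (h₁ : 1 + Complex.I * v ≠ 0)
    (h₂ : 1 - Complex.I * v ≠ 0) :
    (shiftedChebyshev n).eval (1 / (1 + v ^ 2)) =
      (((1 + Complex.I * v) / (1 - Complex.I * v)) ^ n +
        ((1 - Complex.I * v) / (1 + Complex.I * v)) ^ n) / 2 := by
  set w := (1 + Complex.I * v) / (1 - Complex.I * v) with hw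
  have hw0 : w ≠ 0 := div_ne_zero h₁ h₂
  have hwi : (1 - Complex.I * v) / (1 + Complex.I * v) = w⁻¹ := by rw [hw, inv_div]
  obtain ⟨θ', hθ'⟩ : ∃ θ', Complex.exp θ' = w := ⟨_, Complex.exp_log hw0⟩
  obtain ⟨θ, rfl⟩ : ∃ θ, θ' = θ * Complex.I := ⟨-θ' * Complex.I, by
    linear_combination θ' * Complex.I_sq⟩
  have hfac : (1 : ℂ) + v ^ 2 = (1 + Complex.I * v) * (1 - Complex.I * v) := by
    linear_combination (v ^ 2) * Complex.I_sq
  have hcos : (2 : ℂ) * (1 / (1 + v ^ 2)) - 1 = Complex.cos θ := by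
    rw [Complex.cos, neg_mul, Complex.exp_neg, hθ', hw, hfac, inv_div]
    field_simp
    ring
  rw [shiftedChebyshev, eval_comp, hwi]
  simp only [eval_sub, eval_mul, eval_C, eval_X, eval_one]
  rw [hcos, Chebyshev.T_complex_cos, Complex.cos, inv_pow, ← hθ', ← Complex.exp_nat_mul,
    ← Complex.exp_neg]
  push_cast
  ring_nf

theorem normSq_one_add_I_mul (v : ℂ) : ‖1 + Complex.I * v‖ ^ 2 = (1 - v.im) ^ 2 + v.re ^ 2 := by
  rw [← Complex.normSq_eq_norm_sq, Complex.normSq_apply]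
  simp
  ring

theorem normSq_one_sub_I_mul (v : ℂ) : ‖1 - Complex.I * v‖ ^ 2 = (1 + v.im) ^ 2 + v.re ^ 2 := by
  rw [← Complex.normSq_eq_norm_sq, Complex.normSq_apply]
  simp
  ring

theorem one_add_I_mul_ne_zero {v : ℂ} (h : |v.im| < 1) : 1 + Complex.I * v ≠ 0 := by
  intro h0
  have := normSq_one_add_I_mul v
  rw [h0] at this
  simp at this
  nlinarith [(abs_lt.1 h).2, sq_nonneg v.re]

theorem one_sub_I_mul_ne_zero {v : ℂ} (h : |v.im| < 1) : 1 - Complex.I * v ≠ 0 := by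
  intro h0
  have := normSq_one_sub_I_mul v
  rw [h0] at this
  simp at this
  nlinarith [(abs_lt.1 h).1, sq_nonneg v.re]

theorem one_add_sq_ne_zero {v : ℂ} (h : |v.im| < 1) : 1 + v ^ 2 ≠ 0 := by
  have hfac : (1 : ℂ) + v ^ 2 = (1 + Complex.I * v) * (1 - Complex.I * v) := by
    linear_combination (v ^ 2) * Complex.I_sq
  rw [hfac]
  exact mul_ne_zero (one_add_I_mul_ne_zero h) (one_sub_I_mul_ne_zero h)

/-- In a narrow strip around the real axis (the preimage of a neighbourhood of `[0, 1]`) the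
shifted Chebyshev polynomials grow at a small exponential rate. -/
theorem norm_eval_shiftedChebyshev_le (n : ℕ) {v : ℂ} {δ : ℝ} (hδ : δ ≤ 1 / 2)
    (hv : |v.im| ≤ δ) :
    ‖(shiftedChebyshev n).eval (1 / (1 + v ^ 2))‖ ≤ Real.exp (8 * δ * n) := by
  have hv1 : |v.im| < 1 := by linarith
  obtain ⟨hlo, hhi⟩ := abs_le.1 hv
  have z₁ := one_add_I_mul_ne_zero hv1
  have z₂ := one_sub_I_mul_ne_zero hv1
  have e₁ := normSq_one_add_I_mul v
  have e₂ := normSq_one_sub_I_mul v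
  have key : ∀ r t : ℝ, 0 ≤ r → 0 < t → r ^ 2 ≤ t ^ 2 + 4 * δ → 1 / 4 ≤ t ^ 2 →
      r / t ≤ Real.exp (8 * δ) := by
    intro r t hr ht h1 h2
    rw [div_le_iff₀ ht]
    refine le_of_sq_le_sq ?_ (by positivity)
    have h3 : 1 + 16 * δ ≤ Real.exp (8 * δ) ^ 2 := by
      rw [← Real.exp_nat_mul]
      have := Real.add_one_le_exp (((2 : ℕ) : ℝ) * (8 * δ))
      push_cast at this ⊢
      linarith
    rw [mul_pow]
    have h0 : 0 ≤ δ := (abs_nonneg _).trans hv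
    nlinarith
  have k₁ : ‖(1 + Complex.I * v) / (1 - Complex.I * v)‖ ≤ Real.exp (8 * δ) := by
    rw [norm_div]
    refine key _ _ (norm_nonneg _) (norm_pos_iff.2 z₂) ?_ ?_
    · rw [e₁, e₂]; linarith
    · rw [e₂]; nlinarith [sq_nonneg v.re]
  have k₂ : ‖(1 - Complex.I * v) / (1 + Complex.I * v)‖ ≤ Real.exp (8 * δ) := by
    rw [norm_div]
    refine key _ _ (norm_nonneg _) (norm_pos_iff.2 z₁) ?_ ?_
    · rw [e₁, e₂]; linarith
    · rw [e₁]; nlinarith [sq_nonneg v.re]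
  rw [eval_shiftedChebyshev n z₁ z₂, norm_div, Complex.norm_ofNat]
  have p₁ := pow_le_pow_left₀ (norm_nonneg _) k₁ n
  have p₂ := pow_le_pow_left₀ (norm_nonneg _) k₂ n
  rw [← norm_pow] at p₁ p₂
  have : Real.exp (8 * δ) ^ n = Real.exp (8 * δ * n) := by
    rw [← Real.exp_nat_mul]; ring_nf
  rw [this] at p₁ p₂
  linarith [norm_add_le (((1 + Complex.I * v) / (1 - Complex.I * v)) ^ n)
    (((1 - Complex.I * v) / (1 + Complex.I * v)) ^ n)]

/-- On the line `Im v = η` the shifted Chebyshev polynomials grow exponentially; the rate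
degenerates as `Re v → ±∞`. -/
theorem le_norm_eval_shiftedChebyshev {n : ℕ} (hn : n ≠ 0) {v : ℂ} {η : ℝ} (hη : 0 < η)
    (hη1 : η < 1) (hv : v.im = η) :
    Real.exp (2 * η * n / ((1 + η) ^ 2 + v.re ^ 2)) * (2 * η / ((1 + η) ^ 2 + v.re ^ 2)) ≤
      ‖(shiftedChebyshev n).eval (1 / (1 + v ^ 2))‖ := by
  have hv1 : |v.im| < 1 := by rw [hv, abs_of_pos hη]; exact hη1
  have z₁ := one_add_I_mul_ne_zero hv1
  have z₂ := one_sub_I_mul_ne_zero hv1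
  have e₁ := normSq_one_add_I_mul v
  have e₂ := normSq_one_sub_I_mul v
  rw [hv] at e₁ e₂
  set D := (1 + η) ^ 2 + v.re ^ 2 with hD
  have hDpos : 0 < D := by positivity
  rw [eval_shiftedChebyshev n z₁ z₂, norm_div, Complex.norm_ofNat]
  set w := (1 + Complex.I * v) / (1 - Complex.I * v) with hw
  have hw0 : w ≠ 0 := div_ne_zero z₁ z₂
  have hwi : (1 - Complex.I * v) / (1 + Complex.I * v) = w⁻¹ := by rw [hw, inv_div]
  rw [hwi]
  have hwpos : 0 < ‖w‖ := norm_pos_iff.2 hw0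
  have hw2 : ‖w‖ ^ 2 = 1 - 4 * η / D := by
    rw [hw, norm_div, div_pow, e₁, e₂]
    field_simp
    rw [hD]
    ring
  have hwle : ‖w‖ ^ 2 ≤ 1 := by
    rw [hw2]; have : 0 < 4 * η / D := by positivity
    linarith
  have hwexp : ‖w‖ ≤ Real.exp (-(2 * η / D)) := by
    refine le_of_sq_le_sq ?_ (Real.exp_pos _).le
    rw [hw2, ← Real.exp_nat_mul]
    have := Real.add_one_le_exp (((2 : ℕ) : ℝ) * -(2 * η / D))
    refine le_trans (le_of_eq ?_) this
    push_cast
    ring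
  have hinv : Real.exp (2 * η * n / D) ≤ ‖w⁻¹ ^ n‖ := by
    have h1 : Real.exp (2 * η / D) ≤ ‖w⁻¹‖ := by
      rw [norm_inv, le_inv_comm₀ (Real.exp_pos _) hwpos, ← Real.exp_neg]
      exact hwexp
    have h2 := pow_le_pow_left₀ (Real.exp_pos _).le h1 n
    rw [norm_pow]
    refine le_trans (le_of_eq ?_) h2
    rw [← Real.exp_nat_mul]
    congr 1
    ring
  have hwn : ‖w ^ n‖ = ‖w⁻¹ ^ n‖ * (‖w‖ ^ 2) ^ n := by
    rw [norm_pow, norm_pow, norm_inv, ← mul_pow]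
    congr 1
    field_simp
  have hpow : (‖w‖ ^ 2) ^ n ≤ ‖w‖ ^ 2 := pow_le_of_le_one (by positivity) hwle hn
  have tri : ‖w⁻¹ ^ n‖ - ‖w ^ n‖ ≤ ‖w ^ n + w⁻¹ ^ n‖ := by
    have := norm_sub_le (w ^ n + w⁻¹ ^ n) (w ^ n)
    rw [add_sub_cancel_left] at this
    linarith
  rw [le_div_iff₀ two_pos]
  refine le_trans ?_ tri
  rw [hwn]
  have hq : 4 * η / D = 1 - ‖w‖ ^ 2 := by linarith
  have hnn : 0 ≤ 4 * η / D := by positivity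
  calc Real.exp (2 * η * n / D) * (2 * η / D) * 2
      = Real.exp (2 * η * n / D) * (4 * η / D) := by ring
    _ ≤ ‖w⁻¹ ^ n‖ * (4 * η / D) := by gcongr
    _ = ‖w⁻¹ ^ n‖ * (1 - ‖w‖ ^ 2) := by rw [hq]
    _ ≤ ‖w⁻¹ ^ n‖ * (1 - (‖w‖ ^ 2) ^ n) := by gcongr
    _ = ‖w⁻¹ ^ n‖ - ‖w⁻¹ ^ n‖ * (‖w‖ ^ 2) ^ n := by ring

/-- The difference quotient of a polynomial, expanded in powers of one of its arguments. -/
theorem exists_eval_sub_eval_eq_mul_sum {n : ℕ} :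
    ∀ q : ℂ[X], q.natDegree ≤ n → ∃ d : ℕ → ℂ[X], ∀ Y y : ℂ,
      q.eval Y - q.eval y = (Y - y) * ∑ j ∈ Finset.range n, (d j).eval Y * y ^ j := by
  induction n with
  | zero =>
    intro q hq
    refine ⟨0, fun Y y => ?_⟩
    rw [eq_C_of_natDegree_le_zero hq]
    simp
  | succ n ih =>
    intro q hq
    obtain ⟨d, hd⟩ := ih q.divX (by rw [natDegree_divX_eq_natDegree_tsub_one]; omega)
    refine ⟨fun j => Nat.casesOn j q.divX d, fun Y y => ?_⟩
    rw [Finset.sum_range_succ']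
    have e : ∀ z, q.eval z = q.divX.eval z * z + q.coeff 0 := by
      intro z
      conv_lhs => rw [← divX_mul_X_add q]
      simp
    have s : ∑ k ∈ Finset.range n, (d k).eval Y * y ^ (k + 1) =
        y * ∑ k ∈ Finset.range n, (d k).eval Y * y ^ k := by
      rw [Finset.mul_sum]
      exact Finset.sum_congr rfl fun k _ => by ring
    simp only
    rw [s, e Y, e y]
    linear_combination y * hd Y y

/-! ### Approximation of even entire functions -/

open MeasureTheory Complex in
/-- An even entire function that decays on the strip `|Im v| ≤ η` is approximated by a polynomial
in `1 / (1 + v²)` without constant term, with an explicit bound for the error.  The approximant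
arises from the Cauchy integral by replacing the kernel with its interpolant at the zeros of the
shifted Chebyshev polynomial, so the error is a Hermite-type contour integral. -/
theorem exists_polynomial_approx_of_even {G : ℂ → ℂ} (hG : Differentiable ℂ G)
    (heven : ∀ v, G (-v) = G v) {n : ℕ} (hn : n ≠ 0) {η δ B : ℝ} (hη : 0 < η) (hη1 : η ≤ 1 / 2)
    (hδη : δ ≤ η / 2)
    (hB : ∀ v : ℂ, |v.im| ≤ η → ‖G v‖ ≤ B) {g : ℝ → ℝ}
    (hg : ∀ x : ℝ, ‖G (x + η * I)‖ ≤ g x) (hgi : Integrable (fun x => g x * (1 + x ^ 2) ^ 2)) :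
    ∃ P : ℂ[X], P.natDegree ≤ n ∧ P.eval 0 = 0 ∧ ∀ v₀ : ℂ, |v₀.im| ≤ δ →
      ‖G v₀ - P.eval (1 / (1 + v₀ ^ 2))‖ ≤ 32 / η ^ 3 *
        ∫ x : ℝ, g x * (1 + x ^ 2) ^ 2 * Real.exp (8 * δ * n - 2 * η * n / (4 + x ^ 2)) := by
  set q := shiftedChebyshev n with hq
  obtain ⟨d, hd⟩ := exists_eval_sub_eval_eq_mul_sum q (natDegree_shiftedChebyshev_le n)
  let V : ℝ → ℂ := fun x => x + η * I
  have hVre : ∀ x, (V x).re = x := fun x => by simp [V]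
  have hVim : ∀ x, (V x).im = η := fun x => by simp [V]
  have hVim1 : ∀ x, |(V x).im| < 1 := fun x => by rw [hVim, abs_of_pos hη]; linarith
  have hV1 : ∀ x, 1 + V x ^ 2 ≠ 0 := fun x => one_add_sq_ne_zero (hVim1 x)
  have hVc : Continuous V := by fun_prop
  let Y : ℝ → ℂ := fun x => 1 / (1 + V x ^ 2)
  have hYc : Continuous Y := continuous_const.div (by fun_prop) hV1
  have hg0 : ∀ x, 0 ≤ g x := fun x => (norm_nonneg _).trans (hg x)
  have hqY : ∀ x : ℝ, Real.exp (2 * η * n / (4 + x ^ 2)) * (η / (2 * (1 + x ^ 2))) ≤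
      ‖q.eval (Y x)‖ := by
    intro x
    have h := le_norm_eval_shiftedChebyshev hn hη (by linarith) (hVim x)
    rw [hVre] at h
    refine le_trans ?_ h
    have hD : (1 + η) ^ 2 + x ^ 2 ≤ 4 + x ^ 2 := by nlinarith
    have hD' : (1 + η) ^ 2 + x ^ 2 ≤ 4 * (1 + x ^ 2) := by nlinarith
    have hDpos : 0 < (1 + η) ^ 2 + x ^ 2 := by positivity
    refine mul_le_mul (Real.exp_le_exp.2 (by gcongr)) ?_ (by positivity) (Real.exp_pos _).le
    calc η / (2 * (1 + x ^ 2)) = 2 * η / (4 * (1 + x ^ 2)) := by field_simp; norm_num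
      _ ≤ _ := by gcongr
  have hqYne : ∀ x, q.eval (Y x) ≠ 0 := fun x => norm_pos_iff.1 <|
    lt_of_lt_of_le (by positivity) (hqY x)
  have hqYinv : ∀ x : ℝ, ‖(q.eval (Y x))⁻¹‖ ≤
      2 * (1 + x ^ 2) / η * Real.exp (-(2 * η * n / (4 + x ^ 2))) := by
    intro x
    rw [norm_inv]
    refine (inv_anti₀ (by positivity) (hqY x)).trans (le_of_eq ?_)
    rw [Real.exp_neg]
    field_simp
  have hVn : ∀ x : ℝ, ‖2 * V x‖ ≤ 4 * (1 + x ^ 2) := by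
    intro x
    have : ‖V x‖ ≤ |x| + η := by
      refine (norm_add_le _ _).trans (le_of_eq ?_)
      simp [abs_of_pos hη]
    rw [norm_mul, Complex.norm_ofNat]
    nlinarith [sq_abs x, sq_nonneg (|x| - 1)]
  have hYn : ∀ x : ℝ, ‖Y x‖ ≤ 4 := by
    intro x
    have h₁ := normSq_one_add_I_mul (V x)
    have h₂ := normSq_one_sub_I_mul (V x)
    rw [hVre, hVim] at h₁ h₂
    have hfac : (1 : ℂ) + V x ^ 2 = (1 + I * V x) * (1 - I * V x) := by
      linear_combination (V x ^ 2) * I_sq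
    have k₁ : 1 / 2 ≤ ‖1 + I * V x‖ := by
      refine le_of_sq_le_sq ?_ (norm_nonneg _)
      rw [h₁]; nlinarith [sq_nonneg x]
    have k₂ : 1 / 2 ≤ ‖1 - I * V x‖ := by
      refine le_of_sq_le_sq ?_ (norm_nonneg _)
      rw [h₂]; nlinarith [sq_nonneg x]
    simp only [Y]
    rw [norm_div, norm_one, hfac, norm_mul, div_le_iff₀ (by positivity)]
    nlinarith
  -- polynomials are bounded along the curve `Y`, which stays in a disc
  have hdbd : ∀ j, ∃ M, ∀ x, ‖(d j).eval (Y x)‖ ≤ M := by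
    intro j
    obtain ⟨M, hM⟩ := (isCompact_closedBall (0 : ℂ) 4).exists_bound_of_continuousOn
      (f := fun z => (d j).eval z) (d j).continuous.continuousOn
    exact ⟨M, fun x => hM _ (by simpa using hYn x)⟩
  let κ : ℝ → ℂ := fun x => G (V x) * (2 * V x) * (q.eval (Y x))⁻¹
  have hκc : Continuous κ := by
    refine ((hG.continuous.comp hVc).mul (continuous_const.mul hVc)).mul ?_
    exact Continuous.inv₀ (q.continuous.comp hYc) hqYne
  have hκn : ∀ x : ℝ, ‖κ x‖ ≤
      8 / η * (g x * (1 + x ^ 2) ^ 2 * Real.exp (-(2 * η * n / (4 + x ^ 2)))) := by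
    intro x
    simp only [κ]
    rw [norm_mul, norm_mul]
    calc ‖G (V x)‖ * ‖2 * V x‖ * ‖(q.eval (Y x))⁻¹‖
        ≤ g x * (4 * (1 + x ^ 2)) *
          (2 * (1 + x ^ 2) / η * Real.exp (-(2 * η * n / (4 + x ^ 2)))) := by
          gcongr
          · exact mul_nonneg (hg0 x) (by positivity)
          · exact hg0 x
          · exact hg x
          · exact hVn x
          · exact hqYinv x
      _ = _ := by field_simp; ring
  have hκi : Integrable κ := by
    refine (hgi.const_mul (8 / η)).mono' hκc.aestronglyMeasurable (Eventually.of_forall fun x => ?_)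
    refine (hκn x).trans ?_
    have h1 : Real.exp (-(2 * η * n / (4 + x ^ 2))) ≤ 1 := by
      rw [Real.exp_le_one_iff, neg_nonpos]; positivity
    have h2 : 0 ≤ g x * (1 + x ^ 2) ^ 2 := mul_nonneg (hg0 x) (by positivity)
    exact mul_le_mul_of_nonneg_left (mul_le_of_le_one_right h2 h1) (by positivity)
  have hci : ∀ j, Integrable (fun x => κ x * (Y x * (d j).eval (Y x))) := by
    intro j
    obtain ⟨M, hM⟩ := hdbd j
    refine hκi.mul_bdd (c := 4 * M)
      (hYc.mul ((d j).continuous.comp hYc)).aestronglyMeasurable (Eventually.of_forall fun x => ?_)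
    rw [norm_mul]
    exact mul_le_mul (hYn x) (hM x) (norm_nonneg _) (by norm_num)
  have hGi : Integrable (fun x : ℝ => G (x + η * I)) := by
    refine hgi.mono' (hG.continuous.comp hVc).aestronglyMeasurable (Eventually.of_forall fun x => ?_)
    refine (hg x).trans ?_
    have := hg0 x
    have h1 : 1 ≤ (1 + x ^ 2) ^ 2 := by nlinarith [sq_nonneg x, sq_nonneg (x ^ 2)]
    nlinarith
  let P : ℂ[X] := ∑ j ∈ Finset.range n,
    C ((2 * Real.pi * I)⁻¹ * ∫ x, κ x * (Y x * (d j).eval (Y x))) * X ^ (j + 1)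
  have hpi : (2 * Real.pi * I : ℂ) ≠ 0 := by simp [Real.pi_ne_zero]
  refine ⟨P, ?_, ?_, ?_⟩
  · refine natDegree_sum_le_of_forall_le _ _ fun j hj => ?_
    refine (natDegree_C_mul_X_pow_le _ _).trans ?_
    have := Finset.mem_range.1 hj
    omega
  · simp [P, eval_finsetSum]
  · intro v₀ hv₀
    have hv₀η : |v₀.im| < η := by linarith
    have hv₀1 : |v₀.im| < 1 := by linarith
    have hy1 := one_add_sq_ne_zero hv₀1
    set y := 1 / (1 + v₀ ^ 2) with hy
    have hdist : ∀ x, η ^ 2 / 4 ≤ ‖v₀ ^ 2 - V x ^ 2‖ := by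
      intro x
      obtain ⟨hl, hh⟩ := abs_le.1 hv₀
      have k₁ : η / 2 ≤ ‖V x - v₀‖ := by
        refine le_trans ?_ ((le_abs_self _).trans (abs_im_le_norm _))
        rw [sub_im, hVim]; linarith
      have k₂ : η / 2 ≤ ‖V x + v₀‖ := by
        refine le_trans ?_ ((le_abs_self _).trans (abs_im_le_norm _))
        rw [add_im, hVim]; linarith
      have : v₀ ^ 2 - V x ^ 2 = -((V x - v₀) * (V x + v₀)) := by ring
      rw [this, norm_neg, norm_mul]
      nlinarith
    have hdne : ∀ x, v₀ ^ 2 - V x ^ 2 ≠ 0 := fun x => norm_pos_iff.1 <|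
      lt_of_lt_of_le (by positivity) (hdist x)
    -- the Hermite remainder formula for the Cauchy kernel
    have hkernel : ∀ x, G (V x) * (2 * V x / (v₀ ^ 2 - V x ^ 2)) =
        (∑ j ∈ Finset.range n, κ x * (Y x * (d j).eval (Y x)) * y ^ (j + 1)) +
        κ x * (q.eval y / (v₀ ^ 2 - V x ^ 2)) := by
      intro x
      have hs : ∑ j ∈ Finset.range n, κ x * (Y x * (d j).eval (Y x)) * y ^ (j + 1) =
          κ x * (Y x * y) * ∑ j ∈ Finset.range n, (d j).eval (Y x) * y ^ j := by
        rw [Finset.mul_sum]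
        exact Finset.sum_congr rfl fun j _ => by ring
      have hYy : Y x - y = (v₀ ^ 2 - V x ^ 2) * (Y x * y) := by
        simp only [Y, hy]
        have := hV1 x
        field_simp
        ring
      have hsum := hd (Y x) y
      rw [hYy] at hsum
      have hS : (Y x * y) * ∑ j ∈ Finset.range n, (d j).eval (Y x) * y ^ j =
          (q.eval (Y x) - q.eval y) / (v₀ ^ 2 - V x ^ 2) := by
        rw [eq_div_iff (hdne x), hsum]; ring
      rw [hs, mul_assoc, hS]
      simp only [κ]
      have h1 := hqYne x
      have h2 := hdne x
      field_simp
      ring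
    have hri : Integrable fun x => κ x * (q.eval y / (v₀ ^ 2 - V x ^ 2)) := by
      have hc : Continuous fun x => q.eval y / (v₀ ^ 2 - V x ^ 2) :=
        continuous_const.div (by fun_prop) hdne
      refine hκi.mul_bdd (c := ‖q.eval y‖ / (η ^ 2 / 4)) hc.aestronglyMeasurable
        (Eventually.of_forall fun x => ?_)
      rw [norm_div]
      have := hdist x
      gcongr
    have hcauchy := integral_cauchy_strip_of_even hG heven hv₀η hB hGi
    have hsplit : 2 * Real.pi * I * G v₀ = 2 * Real.pi * I * P.eval y +
        ∫ x, κ x * (q.eval y / (v₀ ^ 2 - V x ^ 2)) := by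
      rw [← hcauchy]
      have : ∀ x : ℝ, G (x + η * I) * (2 * ((x : ℂ) + η * I) /
          (v₀ ^ 2 - ((x : ℂ) + η * I) ^ 2)) = _ := hkernel
      simp_rw [this]
      rw [integral_add (integrable_finsetSum _ fun j _ => (hci j).mul_const _) hri,
        integral_finsetSum _ fun j _ => (hci j).mul_const _]
      congr 1
      simp only [P, eval_finsetSum, eval_mul, eval_C, eval_pow, eval_X]
      rw [Finset.mul_sum]
      refine Finset.sum_congr rfl fun j _ => ?_
      rw [integral_mul_const]
      field_simp
    have herr : G v₀ - P.eval y = (2 * Real.pi * I)⁻¹ *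
        ∫ x, κ x * (q.eval y / (v₀ ^ 2 - V x ^ 2)) := by
      rw [eq_inv_mul_iff_mul_eq₀ hpi]
      linear_combination hsplit
    have hqy : ‖q.eval y‖ ≤ Real.exp (8 * δ * n) :=
      norm_eval_shiftedChebyshev_le n (by linarith) hv₀
    have hgei : Integrable (fun x : ℝ => g x * (1 + x ^ 2) ^ 2 *
        Real.exp (8 * δ * n - 2 * η * n / (4 + x ^ 2))) := by
      have hc : Continuous fun x : ℝ => Real.exp (8 * δ * n - 2 * η * n / (4 + x ^ 2)) := by
        refine Real.continuous_exp.comp (continuous_const.sub ?_)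
        exact continuous_const.div (by fun_prop) (fun x => by positivity)
      refine hgi.mul_bdd (c := Real.exp (8 * δ * n)) hc.aestronglyMeasurable
        (Eventually.of_forall fun x => ?_)
      rw [Real.norm_of_nonneg (Real.exp_pos _).le]
      refine Real.exp_le_exp.2 ?_
      have : 0 ≤ 2 * η * n / (4 + x ^ 2) := by positivity
      linarith
    rw [herr, norm_mul]
    have hpin : ‖(2 * Real.pi * I : ℂ)⁻¹‖ ≤ 1 := by
      rw [norm_inv]
      refine inv_le_one_of_one_le₀ ?_
      simp only [norm_mul, Complex.norm_ofNat, Complex.norm_real, norm_I, mul_one]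
      rw [Real.norm_of_nonneg Real.pi_pos.le]
      linarith [Real.pi_gt_three]
    calc _ ≤ 1 * ‖∫ x, κ x * (q.eval y / (v₀ ^ 2 - V x ^ 2))‖ := by gcongr
      _ ≤ ∫ x, 32 / η ^ 3 * (g x * (1 + x ^ 2) ^ 2 *
          Real.exp (8 * δ * n - 2 * η * n / (4 + x ^ 2))) := by
        rw [one_mul]
        refine norm_integral_le_of_norm_le (hgei.const_mul _) (Eventually.of_forall fun x => ?_)
        have h0 : 0 ≤ g x * (1 + x ^ 2) ^ 2 * Real.exp (-(2 * η * n / (4 + x ^ 2))) :=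
          mul_nonneg (mul_nonneg (hg0 x) (by positivity)) (Real.exp_pos _).le
        rw [norm_mul, norm_div]
        calc ‖κ x‖ * (‖q.eval y‖ / ‖v₀ ^ 2 - V x ^ 2‖)
            ≤ 8 / η * (g x * (1 + x ^ 2) ^ 2 * Real.exp (-(2 * η * n / (4 + x ^ 2)))) *
              (Real.exp (8 * δ * n) / (η ^ 2 / 4)) := by
              have := hdist x
              have := hκn x
              gcongr
          _ = _ := by
              rw [sub_eq_add_neg, Real.exp_add]
              field_simp
              ring
      _ = _ := by rw [integral_const_mul]

/-! ### Growth of `F` in the uniformizing variable -/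

theorem exists_one_add_rpow_le_mul_exp {b : ℝ} (hb : 0 < b) :
    ∃ K : ℝ, 0 < K ∧ ∀ t : ℝ, 0 ≤ t → 1 + t ^ b ≤ K * Real.exp t := by
  set N := ⌈b⌉₊
  refine ⟨1 + N.factorial * Real.exp 1, by positivity, fun t ht => ?_⟩
  have h₁ : t ^ b ≤ (1 + t) ^ b := Real.rpow_le_rpow ht (by linarith) hb.le
  have h₂ : (1 + t) ^ b ≤ (1 + t) ^ (N : ℝ) :=
    Real.rpow_le_rpow_of_exponent_le (by linarith) (Nat.le_ceil b)
  rw [Real.rpow_natCast] at h₂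
  have h₃ := Real.pow_div_factorial_le_exp (1 + t) (by linarith) N
  rw [div_le_iff₀ (by positivity), Real.exp_add] at h₃
  have h₄ : 1 ≤ Real.exp t := Real.one_le_exp ht
  nlinarith

/-- The two growth conditions merge into one bound, in which polynomial growth along vertical
lines is relaxed to exponential growth: the Gaussian decay gained from `s = -λ v²` absorbs it. -/
theorem exists_norm_le_mul_exp {F : ℂ → ℂ} {a b c a' b' c' x₀ : ℝ} (ha : 0 < a) (hb : 0 < b)
    (hc : 0 < c) (ha' : 0 < a') (hb' : 0 < b') (hc' : 0 < c')
    (hleft : ∀ s : ℂ, s.re ≤ x₀ → ‖F s‖ ≤ c * Real.exp (a * s.re) * (1 + |s.im| ^ b))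
    (hglobal : ∀ s : ℂ, ‖F s‖ ≤ c' * (1 + Real.exp (a' * s.re)) * (1 + |s.im| ^ b')) :
    ∃ B : ℝ, 0 < B ∧ ∀ s : ℂ,
      ‖F s‖ ≤ B * Real.exp (a * s.re + a' * max s.re 0 + |s.im|) := by
  obtain ⟨K, hK, hKb⟩ := exists_one_add_rpow_le_mul_exp hb
  obtain ⟨K', hK', hKb'⟩ := exists_one_add_rpow_le_mul_exp hb'
  refine ⟨c * K + 2 * c' * K' * Real.exp (-(a * x₀)), by positivity, fun s => ?_⟩
  have k := hKb |s.im| (abs_nonneg _)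
  have k' := hKb' |s.im| (abs_nonneg _)
  have hm : 0 ≤ max s.re 0 := le_max_right _ _
  have hm' : s.re ≤ max s.re 0 := le_max_left _ _
  rw [add_mul]
  rcases le_total s.re x₀ with h | h
  · calc ‖F s‖ ≤ c * Real.exp (a * s.re) * (1 + |s.im| ^ b) := hleft s h
      _ ≤ c * Real.exp (a * s.re + a' * max s.re 0) * (K * Real.exp |s.im|) := by
        gcongr
        nlinarith
      _ = c * K * Real.exp (a * s.re + a' * max s.re 0 + |s.im|) := by
        rw [Real.exp_add (a * s.re + a' * max s.re 0)]; ring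
      _ ≤ _ := le_add_of_nonneg_right (by positivity)
  · have h1 : 1 + Real.exp (a' * s.re) ≤ 2 * Real.exp (a' * max s.re 0) := by
      have e₁ : 1 ≤ Real.exp (a' * max s.re 0) := Real.one_le_exp (by positivity)
      have e₂ : Real.exp (a' * s.re) ≤ Real.exp (a' * max s.re 0) :=
        Real.exp_le_exp.2 (by gcongr)
      linarith
    calc ‖F s‖ ≤ c' * (1 + Real.exp (a' * s.re)) * (1 + |s.im| ^ b') := hglobal s
      _ ≤ c' * (2 * Real.exp (a' * max s.re 0)) * (K' * Real.exp |s.im|) := by gcongr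
      _ = 2 * c' * K' * Real.exp (a' * max s.re 0 + |s.im|) := by rw [Real.exp_add]; ring
      _ ≤ 2 * c' * K' * Real.exp (-(a * x₀) + (a * s.re + a' * max s.re 0 + |s.im|)) := by
        refine mul_le_mul_of_nonneg_left (Real.exp_le_exp.2 ?_) (by positivity)
        linarith [mul_le_mul_of_nonneg_left h ha.le]
      _ = 2 * c' * K' * Real.exp (-(a * x₀)) *
          Real.exp (a * s.re + a' * max s.re 0 + |s.im|) := by
        rw [Real.exp_add (-(a * x₀))]; ring
      _ ≤ _ := le_add_of_nonneg_left (by positivity)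

theorem norm_comp_neg_mul_sq_le {F : ℂ → ℂ} {a a' B : ℝ} (ha : 0 < a) (ha' : 0 < a')
    (hB : 0 < B)
    (hF : ∀ s : ℂ, ‖F s‖ ≤ B * Real.exp (a * s.re + a' * max s.re 0 + |s.im|))
    {l η : ℝ} (hl : 0 < l) (hη : 0 < η) {v : ℂ} (hv : |v.im| ≤ η) :
    ‖F (-(l : ℂ) * v ^ 2)‖ ≤
      B * Real.exp (l * ((a + a' + 2 / a) * η ^ 2 - a / 2 * v.re ^ 2)) := by
  refine (hF _).trans ?_
  have hre : (-(l : ℂ) * v ^ 2).re = l * (v.im ^ 2 - v.re ^ 2) := by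
    simp [pow_two]; ring
  have him : (-(l : ℂ) * v ^ 2).im = -(2 * l * (v.re * v.im)) := by
    simp [pow_two]; ring
  have hy : v.im ^ 2 ≤ η ^ 2 := sq_le_sq' (abs_le.1 hv).1 (abs_le.1 hv).2
  gcongr
  have h₁ : (-(l : ℂ) * v ^ 2).re ≤ l * (η ^ 2 - v.re ^ 2) := by
    rw [hre]; gcongr
  have h₂ : max (-(l : ℂ) * v ^ 2).re 0 ≤ l * η ^ 2 := by
    refine max_le (h₁.trans ?_) (by positivity)
    gcongr
    linarith [sq_nonneg v.re]
  have h₃ : |(-(l : ℂ) * v ^ 2).im| ≤ l * (2 * η * |v.re|) := by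
    rw [him, abs_neg, abs_mul (2 * l), abs_mul v.re, abs_of_pos (by positivity : (0 : ℝ) < 2 * l)]
    have := mul_le_mul_of_nonneg_left hv (abs_nonneg v.re)
    nlinarith
  have h₄ : 2 * η * |v.re| ≤ a / 2 * v.re ^ 2 + 2 / a * η ^ 2 := by
    have h : a / 2 * v.re ^ 2 + 2 / a * η ^ 2 - 2 * η * |v.re| =
        (a * |v.re| - 2 * η) ^ 2 / (2 * a) := by
      rw [← sq_abs v.re]; field_simp; ring
    have : 0 ≤ (a * |v.re| - 2 * η) ^ 2 / (2 * a) := by positivity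
    linarith
  have h₅ : |(-(l : ℂ) * v ^ 2).im| ≤ l * (a / 2 * v.re ^ 2 + 2 / a * η ^ 2) :=
    h₃.trans (by gcongr)
  have h₆ := mul_le_mul_of_nonneg_left h₁ ha.le
  have h₇ := mul_le_mul_of_nonneg_left h₂ ha'.le
  linarith

open MeasureTheory in
theorem integrable_one_add_sq_sq_mul_exp_neg {k : ℝ} (hk : 0 < k) :
    Integrable (fun x : ℝ => (1 + x ^ 2) ^ 2 * Real.exp (-k * x ^ 2)) := by
  have hg := (integrable_exp_neg_mul_sq (b := k / 2) (by positivity)).const_mul ((1 + 4 / k) ^ 2)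
  refine hg.mono' (by fun_prop) (Eventually.of_forall fun x => ?_)
  rw [Real.norm_of_nonneg (by positivity)]
  have h₁ : 1 + x ^ 2 ≤ (1 + 4 / k) * Real.exp (k / 4 * x ^ 2) := by
    have := Real.add_one_le_exp (k / 4 * x ^ 2)
    calc 1 + x ^ 2 ≤ (1 + 4 / k) * (k / 4 * x ^ 2 + 1) := by
          have e : (1 + 4 / k) * (k / 4 * x ^ 2 + 1) = 1 + x ^ 2 + (k / 4 * x ^ 2 + 4 / k) := by
            field_simp; ring
          rw [e]
          have : 0 ≤ k / 4 * x ^ 2 + 4 / k := by positivity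
          linarith
      _ ≤ _ := by gcongr
  calc (1 + x ^ 2) ^ 2 * Real.exp (-k * x ^ 2)
      ≤ ((1 + 4 / k) * Real.exp (k / 4 * x ^ 2)) ^ 2 * Real.exp (-k * x ^ 2) := by gcongr
    _ = (1 + 4 / k) ^ 2 * Real.exp (-(k / 2) * x ^ 2) := by
      rw [mul_pow, mul_assoc, ← Real.exp_nat_mul, ← Real.exp_add]
      congr 2
      push_cast
      ring

open MeasureTheory in
/-- Exponentially accurate approximation, in the uniformizing variable `v` with `s = -σ n v²`. -/
theorem exists_polynomial_approx_exp {F : ℂ → ℂ} (hFd : Differentiable ℂ F) {a a' B : ℝ}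
    (ha : 0 < a) (ha' : 0 < a') (hB : 0 < B)
    (hF : ∀ s : ℂ, ‖F s‖ ≤ B * Real.exp (a * s.re + a' * max s.re 0 + |s.im|))
    {σ : ℝ} (hσ : 0 < σ) :
    ∃ δ C K : ℝ, 0 < δ ∧ δ ≤ 1 / 2 ∧ 0 < C ∧ 0 < K ∧ ∀ n : ℕ, n ≠ 0 → ∃ P : ℂ[X],
      P.natDegree ≤ n ∧ P.eval 0 = 0 ∧ ∀ v₀ : ℂ, |v₀.im| ≤ δ →
        ‖F (-((σ * n : ℝ) : ℂ) * v₀ ^ 2) - P.eval (1 / (1 + v₀ ^ 2))‖ ≤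
          K * Real.exp (-C * n) := by
  set A := a + a' + 2 / a with hA
  have hApos : 0 < A := by positivity
  -- For `|Re v| ≤ 1` the growth `A σ η²` must be dominated by the Chebyshev decay, of order `η`;
  -- for `|Re v| ≥ 1` the decay of `F` must suffice. Both hold for a small height `η`.
  obtain ⟨η, hη, hη1, hη2, hη3⟩ : ∃ η : ℝ, 0 < η ∧ η ≤ 1 / 2 ∧ A * σ * η ^ 2 ≤ η / 10 ∧
      η ≤ a * σ / 2 := by
    refine ⟨min (1 / 2) (min (1 / (10 * A * σ)) (a * σ / 2)), by positivity, min_le_left _ _, ?_,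
      (min_le_right _ _).trans (min_le_right _ _)⟩
    set η := min (1 / 2) (min (1 / (10 * A * σ)) (a * σ / 2)) with hη
    have h0 : 0 < η := by positivity
    have h : η ≤ 1 / (10 * A * σ) := (min_le_right _ _).trans (min_le_left _ _)
    rw [le_div_iff₀ (by positivity)] at h
    nlinarith
  set k := a * σ / 4 with hk
  have hkpos : 0 < k := by positivity
  set J := ∫ x : ℝ, (1 + x ^ 2) ^ 2 * Real.exp (-k * x ^ 2) with hJ
  have hJ0 : 0 ≤ J := integral_nonneg fun x => by positivity
  have hi := integrable_one_add_sq_sq_mul_exp_neg hkpos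
  refine ⟨η / 160, η / 4, 32 / η ^ 3 * (B * J) + 1, by positivity, by linarith, by positivity,
    by positivity, fun n hn => ?_⟩
  have hn1 : (1 : ℝ) ≤ n := by exact_mod_cast Nat.one_le_iff_ne_zero.2 hn
  have hl : 0 < σ * n := by positivity
  have hbd : ∀ v : ℂ, |v.im| ≤ η → ‖F (-((σ * n : ℝ) : ℂ) * v ^ 2)‖ ≤
      B * Real.exp (σ * n * (A * η ^ 2 - a / 2 * v.re ^ 2)) := fun v hv =>
    norm_comp_neg_mul_sq_le ha ha' hB hF hl hη hv
  have hexp : ∀ x : ℝ, σ * n * (A * η ^ 2 - a / 2 * x ^ 2) ≤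
      -k * x ^ 2 + σ * n * (A * η ^ 2) := by
    intro x
    have : k * x ^ 2 ≤ σ * n * (a / 2) * x ^ 2 := by
      gcongr
      rw [hk]
      nlinarith [mul_pos ha hσ]
    linarith
  have hmain : ∀ x : ℝ, σ * n * (A * η ^ 2 - a / 2 * x ^ 2) +
      (8 * (η / 160) * n - 2 * η * n / (4 + x ^ 2)) ≤ -k * x ^ 2 + -(η / 4) * n := by
    intro x
    have e₁ : A * σ * η ^ 2 * n ≤ η / 10 * n := by gcongr
    rcases le_total (x ^ 2) 1 with hx | hx
    · have e₂ : 2 * η * n / 5 ≤ 2 * η * n / (4 + x ^ 2) := by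
        gcongr
        linarith
      have e₃ := hexp x
      nlinarith
    · have e₂ : 0 ≤ 2 * η * n / (4 + x ^ 2) := by positivity
      have e₃ : η * n ≤ a * σ / 2 * n := by gcongr
      -- half of the Gaussian exponent is kept for integrability, half gives the decay in `n`
      have e₄ : k * x ^ 2 * 1 ≤ k * x ^ 2 * n := by gcongr
      have e₅ : k * n * 1 ≤ k * n * x ^ 2 := by gcongr
      have e₆ : σ * n * (a / 2 * x ^ 2) = k * x ^ 2 * n + k * n * x ^ 2 := by rw [hk]; ring
      rw [hk] at *
      nlinarith
  obtain ⟨P, hPd, hP0, hP⟩ := exists_polynomial_approx_of_even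
    (G := fun v => F (-((σ * n : ℝ) : ℂ) * v ^ 2)) (hFd.comp (by fun_prop))
    (fun v => by simp only [neg_sq]) hn hη hη1 (δ := η / 160) (by linarith)
    (B := B * Real.exp (σ * n * (A * η ^ 2)))
    (g := fun x => B * Real.exp (σ * n * (A * η ^ 2 - a / 2 * x ^ 2)))
    (fun v hv => (hbd v hv).trans (by
      gcongr
      have : 0 ≤ a / 2 * v.re ^ 2 := by positivity
      linarith))
    (fun x => by
      have := hbd (x + η * Complex.I) (by simp [abs_of_pos hη])
      simpa using this)
    (by
      refine (hi.const_mul (B * Real.exp (σ * n * (A * η ^ 2)))).mono' (by fun_prop)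
        (Eventually.of_forall fun x => ?_)
      rw [Real.norm_of_nonneg (by positivity)]
      calc _ ≤ B * Real.exp (-k * x ^ 2 + σ * n * (A * η ^ 2)) * (1 + x ^ 2) ^ 2 := by
            gcongr
            exact hexp x
        _ = _ := by rw [Real.exp_add]; ring)
  refine ⟨P, hPd, hP0, fun v₀ hv₀ => (hP v₀ hv₀).trans ?_⟩
  have hle : ∫ x : ℝ, B * Real.exp (σ * n * (A * η ^ 2 - a / 2 * x ^ 2)) * (1 + x ^ 2) ^ 2 *
      Real.exp (8 * (η / 160) * n - 2 * η * n / (4 + x ^ 2)) ≤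
      ∫ x : ℝ, B * Real.exp (-(η / 4) * n) * ((1 + x ^ 2) ^ 2 * Real.exp (-k * x ^ 2)) := by
    refine integral_mono_of_nonneg (Eventually.of_forall fun x => by positivity)
      (hi.const_mul _) (Eventually.of_forall fun x => ?_)
    simp only
    calc _ = B * (1 + x ^ 2) ^ 2 * Real.exp (σ * n * (A * η ^ 2 - a / 2 * x ^ 2) +
          (8 * (η / 160) * n - 2 * η * n / (4 + x ^ 2))) := by rw [Real.exp_add]; ring
      _ ≤ B * (1 + x ^ 2) ^ 2 * Real.exp (-k * x ^ 2 + -(η / 4) * n) := by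
        exact mul_le_mul_of_nonneg_left (Real.exp_le_exp.2 (hmain x)) (by positivity)
      _ = _ := by rw [Real.exp_add]; ring
  rw [integral_const_mul] at hle
  calc _ ≤ 32 / η ^ 3 * (B * Real.exp (-(η / 4) * n) * J) := by gcongr
    _ = 32 / η ^ 3 * (B * J) * Real.exp (-(η / 4) * n) := by ring
    _ ≤ _ := by gcongr; linarith

/-! ### Approximants with a single pole -/

theorem isRationalOfType_confluentRational (σ : ℝ) {n : ℕ} {p : ℂ[X]} (hp : p.natDegree ≤ n)
    (hp0 : p.eval 0 = 0) : IsRationalOfType ((n : ℤ) - 1) n (confluentRational σ n p) := by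
  set l : ℂ := (σ : ℂ) * (n : ℂ) with hl
  refine ⟨∑ j ∈ Finset.range n, C (p.coeff (j + 1)) * (X - C l) ^ (n - 1 - j), (X - C l) ^ n,
    pow_ne_zero _ (X_sub_C_ne_zero l), ?_, ?_, ?_⟩
  · intro hne
    have hn : n ≠ 0 := by rintro rfl; simp at hne
    have : (∑ j ∈ Finset.range n, C (p.coeff (j + 1)) * (X - C l) ^ (n - 1 - j)).natDegree
        ≤ n - 1 := by
      refine natDegree_sum_le_of_forall_le _ _ fun j hj => ?_
      refine (natDegree_C_mul_le _ _).trans ?_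
      rw [natDegree_pow, natDegree_X_sub_C, mul_one]
      omega
    omega
  · rw [natDegree_pow, natDegree_X_sub_C, mul_one]
  · intro s hs
    have hc : p.coeff 0 = 0 := by rw [coeff_zero_eq_eval_zero, hp0]
    rw [confluentRational, ← hl, eval_eq_sum_range' (Nat.lt_succ_of_le hp), Finset.sum_range_succ', hc,
      zero_mul, add_zero]
    simp only [eval_finsetSum, eval_mul, eval_C, eval_pow, eval_sub, eval_X] at hs ⊢
    rw [Finset.sum_div]
    refine Finset.sum_congr rfl fun j hj => ?_
    have hj' := Finset.mem_range.1 hj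
    have hsl : s - l ≠ 0 := fun h => by
      rw [h, zero_pow (by omega)] at hs
      exact hs rfl
    clear_value l
    obtain ⟨m, rfl⟩ : ∃ m, n = m + (j + 1) := ⟨n - (j + 1), by omega⟩
    have : m + (j + 1) - 1 - j = m := by omega
    rw [this, pow_add, one_div, inv_pow]
    field_simp
    ring

/-- Under `s = -λ v²` a set on which `Re s` and `|Im s|` are bounded above comes from an
arbitrarily thin strip `|Im v| ≤ δ`, once `λ` is large. -/
theorem exists_eq_neg_mul_sq {s : ℂ} {M R l δ : ℝ} (hM : s.re ≤ M) (hR : |s.im| ≤ R)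
    (hl : 0 < l) (hδ : 0 < δ) (hlM : M ≤ l * (δ ^ 2 / 2)) (hlR : R ≤ l * δ ^ 2) :
    ∃ v : ℂ, s = -(l : ℂ) * v ^ 2 ∧ |v.im| ≤ δ := by
  have hl' : (l : ℂ) ≠ 0 := by exact_mod_cast hl.ne'
  obtain ⟨v, hv⟩ := IsAlgClosed.exists_pow_nat_eq (-s / l) (n := 2) two_pos
  have hs : s = -(l : ℂ) * v ^ 2 := by rw [hv]; field_simp
  refine ⟨v, hs, ?_⟩
  have hre : s.re = l * (v.im ^ 2 - v.re ^ 2) := by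
    rw [hs]; simp [pow_two]; ring
  have him : |s.im| = l * (2 * |v.re * v.im|) := by
    rw [hs]
    have : (-(l : ℂ) * v ^ 2).im = -(l * (2 * (v.re * v.im))) := by
      simp only [pow_two, Complex.mul_im, Complex.neg_im, Complex.ofReal_re,
        Complex.ofReal_im, Complex.mul_re, Complex.neg_re]
      ring
    rw [this, abs_neg, abs_mul, abs_mul, abs_of_pos hl, abs_two]
  have h₁ : v.im ^ 2 - v.re ^ 2 ≤ δ ^ 2 / 2 :=
    le_of_mul_le_mul_left (by linarith) hl
  have h₂ : 2 * |v.re * v.im| ≤ δ ^ 2 :=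
    le_of_mul_le_mul_left (by linarith) hl
  have h₃ : (v.re * v.im) ^ 2 ≤ (δ ^ 2 / 2) ^ 2 := by
    rw [← sq_abs]
    exact pow_le_pow_left₀ (abs_nonneg _) (by linarith) 2
  refine abs_le_of_sq_le_sq ?_ hδ.le
  by_contra! h
  have hδ2 : 0 < δ ^ 2 := by positivity
  nlinarith [mul_le_mul_of_nonneg_left h₁ (sq_nonneg v.im)]

/-- Adding a small multiple of the top power makes the degree of an approximant exactly `n`. -/
theorem exists_natDegree_eq {n : ℕ} (hn : n ≠ 0) {P : ℂ[X]} (hP : P.natDegree ≤ n)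
    (hP0 : P.eval 0 = 0) {ε : ℝ} (hε : 0 < ε) :
    ∃ p : ℂ[X], p.natDegree = n ∧ p.eval 0 = 0 ∧
      ∀ z : ℂ, ‖z‖ ≤ 1 → ‖P.eval z - p.eval z‖ ≤ ε := by
  rcases hP.eq_or_lt with h | h
  · exact ⟨P, h, hP0, fun z _ => by simpa using hε.le⟩
  · have hε' : (ε : ℂ) ≠ 0 := by exact_mod_cast hε.ne'
    refine ⟨P + C (ε : ℂ) * X ^ n, ?_, ?_, fun z hz => ?_⟩
    · rw [natDegree_add_eq_right_of_natDegree_lt, natDegree_C_mul_X_pow _ _ hε']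
      rwa [natDegree_C_mul_X_pow _ _ hε']
    · simp [hP0, hn]
    · have : P.eval z - (P + C (ε : ℂ) * X ^ n).eval z = -((ε : ℂ) * z ^ n) := by simp
      rw [this, norm_neg, norm_mul, norm_pow, Complex.norm_real, Real.norm_of_nonneg hε.le]
      exact mul_le_of_le_one_right hε.le (pow_le_one₀ (norm_nonneg _) hz)

/-- For all large `n` there is an approximant with a pole at `σ n` of order exactly `n`. -/
theorem eventually_exists_confluentRational {E : Set ℂ}
    (hRe : BddAbove ((fun s : ℂ => s.re) '' E)) (hIm : BddAbove ((fun s : ℂ => |s.im|) '' E))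
    {F : ℂ → ℂ} (hFd : Differentiable ℂ F) {a a' B : ℝ}
    (ha : 0 < a) (ha' : 0 < a') (hB : 0 < B)
    (hF : ∀ s : ℂ, ‖F s‖ ≤ B * Real.exp (a * s.re + a' * max s.re 0 + |s.im|))
    {σ : ℝ} (hσ : 0 < σ) :
    ∃ C : ℝ, 0 < C ∧ ∀ᶠ n : ℕ in atTop, ∃ p : ℂ[X], p.natDegree = n ∧ p.eval 0 = 0 ∧
      (σ : ℂ) * (n : ℂ) ∉ E ∧
      ∀ s ∈ E, ‖F s - confluentRational σ n p s‖ ≤ Real.exp (-C * n) := by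
  obtain ⟨δ, c, K, hδ, hδ1, hc, hK, happ⟩ := exists_polynomial_approx_exp hFd ha ha' hB hF hσ
  obtain ⟨M, hM⟩ := hRe
  obtain ⟨R, hR⟩ := hIm
  have hM' : ∀ s ∈ E, s.re ≤ M := fun s hs => hM ⟨s, hs, rfl⟩
  have hR' : ∀ s ∈ E, |s.im| ≤ R := fun s hs => hR ⟨s, hs, rfl⟩
  set m := min c 1 with hm
  have hmpos : 0 < m := by positivity
  have hlam : Tendsto (fun n : ℕ => σ * (n : ℝ)) atTop atTop :=
    tendsto_natCast_atTop_atTop.const_mul_atTop hσ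
  refine ⟨m / 2, by positivity, ?_⟩
  have ev₁ := (hlam.atTop_mul_const (by positivity : 0 < δ ^ 2 / 2)).eventually_ge_atTop M
  have ev₂ := (hlam.atTop_mul_const (by positivity : 0 < δ ^ 2)).eventually_ge_atTop R
  have ev₃ := hlam.eventually_ge_atTop (M + 1)
  -- half of the rate is spent on the constant factor `K + 1`
  have ev₄ := ((Real.tendsto_exp_atTop.comp (tendsto_natCast_atTop_atTop (R := ℝ)
    |>.const_mul_atTop (by positivity : 0 < m / 2)))).eventually_ge_atTop (K + 1)
  filter_upwards [ev₁, ev₂, ev₃, ev₄, eventually_gt_atTop 0] with n h₁ h₂ h₃ h₄ hn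
  have hn0 : n ≠ 0 := hn.ne'
  have hl : 0 < σ * n := by positivity
  set l : ℝ := σ * n with hldef
  have hlc : ((σ : ℂ) * (n : ℂ)) = (l : ℂ) := by rw [hldef]; push_cast; ring
  obtain ⟨P, hPd, hP0, hP⟩ := happ n hn0
  -- `1 / (1 + v²) = -l / (s - l)` when `s = -l v²`
  obtain ⟨p, hpd, hp0, hp⟩ := exists_natDegree_eq (P := P.comp (C (-(l : ℂ)) * X)) hn0
    (natDegree_comp_le.trans <| (Nat.mul_le_mul hPd
      ((natDegree_C_mul_le _ _).trans natDegree_X_le)).trans (mul_one n).le)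
    (by simpa [eval_comp] using hP0) (Real.exp_pos (-m * n))
  have hnotE : (l : ℂ) ∉ E := fun h => by
    have := hM' _ h
    rw [Complex.ofReal_re] at this
    linarith
  refine ⟨p, hpd, hp0, by rwa [hlc], fun s hs => ?_⟩
  rw [confluentRational, hlc]
  have hdist : 1 ≤ ‖s - l‖ := by
    have h := (neg_le_abs _).trans (Complex.abs_re_le_norm (s - l))
    have := hM' s hs
    rw [Complex.sub_re, Complex.ofReal_re] at h
    linarith
  have hz : ‖1 / (s - (l : ℂ))‖ ≤ 1 := by
    rw [norm_div, norm_one]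
    exact div_le_one_of_le₀ hdist (norm_nonneg _)
  obtain ⟨v, hv, hvδ⟩ := exists_eq_neg_mul_sq (hM' s hs) (hR' s hs) hl hδ h₁ h₂
  have e₁ := hP v hvδ
  rw [← hldef, ← hv] at e₁
  have e₂ := hp _ hz
  have hy : 1 / (1 + v ^ 2) = -(l : ℂ) * (1 / (s - l)) := by
    have h0 := one_add_sq_ne_zero (v := v) (by linarith)
    have hl' : (l : ℂ) ≠ 0 := by exact_mod_cast hl.ne'
    have : s - l = -l * (1 + v ^ 2) := by rw [hv]; ring
    rw [this]
    field_simp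
  rw [hy] at e₁
  simp only [eval_comp, eval_mul, eval_C, eval_X] at e₂
  calc ‖F s - p.eval (1 / (s - l))‖
      ≤ ‖F s - P.eval (-(l : ℂ) * (1 / (s - l)))‖ +
        ‖P.eval (-(l : ℂ) * (1 / (s - l))) - p.eval (1 / (s - l))‖ :=
        norm_sub_le_norm_sub_add_norm_sub _ _ _
    _ ≤ K * Real.exp (-c * n) + Real.exp (-m * n) := add_le_add e₁ e₂
    _ ≤ K * Real.exp (-m * n) + Real.exp (-m * n) := by
      gcongr
      exact min_le_left _ _
    _ = (K + 1) * Real.exp (-m * n) := by ring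
    _ ≤ Real.exp (m / 2 * n) * Real.exp (-m * n) := by
      gcongr
      exact h₄
    _ = Real.exp (-(m / 2) * n) := by rw [← Real.exp_add]; ring_nf

theorem theorem4p3
    (E : Set ℂ)
    (hRe : BddAbove ((fun s : ℂ => s.re) '' E))
    (hIm : BddAbove ((fun s : ℂ => |s.im|) '' E))
    (F : ℂ → ℂ) (hF : Differentiable ℂ F)
    (a b c a' b' c' : ℝ)
    (ha : 0 < a) (hb : 0 < b) (hc : 0 < c) (ha' : 0 < a') (hb' : 0 < b') (hc' : 0 < c')
    (hleft : ∃ x₀ : ℝ, ∀ s : ℂ, s.re ≤ x₀ →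
      ‖F s‖ ≤ c * Real.exp (a * s.re) * (1 + |s.im| ^ b))
    (hglobal : ∀ s : ℂ,
      ‖F s‖ ≤ c' * (1 + Real.exp (a' * s.re)) * (1 + |s.im| ^ b')) :
    ∃ σ₀ : ℝ, 0 < σ₀ ∧ ∀ σ : ℝ, 0 < σ → σ < σ₀ →
      ∃ C : ℝ, 0 < C ∧ ∃ p : ℕ → ℂ[X],
        -- the form of the approximants, for every `n`; a nonzero one has its pole off `E`
        (∀ n : ℕ, (p n).natDegree ≤ n ∧ (p n).eval 0 = 0 ∧
          IsRationalOfType ((n : ℤ) - 1) n (confluentRational σ n (p n)) ∧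
          (p n ≠ 0 → (σ : ℂ) * (n : ℂ) ∉ E)) ∧
        -- exponential convergence for every `n`, up to a constant factor
        (∃ K : ℝ, 0 < K ∧ ∀ n : ℕ, ∀ s ∈ E,
          ‖F s - confluentRational σ n (p n) s‖ ≤ K * Real.exp (-C * n)) ∧
        -- for all large `n`: exact degree, pole off `E`, and no constant factor
        (∀ᶠ n : ℕ in atTop, (p n).natDegree = n ∧ (σ : ℂ) * (n : ℂ) ∉ E ∧
          ∀ s ∈ E, ‖F s - confluentRational σ n (p n) s‖ ≤ Real.exp (-C * n)) := by
  obtain ⟨x₀, hleft⟩ := hleft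
  obtain ⟨B, hB, hgrowth⟩ := exists_norm_le_mul_exp ha hb hc ha' hb' hc' hleft hglobal
  refine ⟨1, one_pos, fun σ hσ _ => ?_⟩
  obtain ⟨C, hC, hev⟩ := eventually_exists_confluentRational hRe hIm hF ha ha' hB hgrowth hσ
  obtain ⟨N, hN⟩ := eventually_atTop.1 hev
  choose! q hqd hq0 hqE hq using hN
  -- below the threshold `N` the zero polynomial serves, since `F` is bounded on `E`
  obtain ⟨D, hD⟩ : ∃ D : ℝ, ∀ s ∈ E, ‖F s‖ ≤ D := by
    obtain ⟨M, hM⟩ := hRe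
    obtain ⟨R, hR⟩ := hIm
    refine ⟨B * Real.exp (a * M + a' * max M 0 + R), fun s hs => (hgrowth s).trans ?_⟩
    have h₁ : s.re ≤ M := hM ⟨s, hs, rfl⟩
    have h₂ : |s.im| ≤ R := hR ⟨s, hs, rfl⟩
    gcongr
  refine ⟨C, hC, fun n => if N ≤ n then q n else 0, fun n => ?_,
    ⟨1 + |D| * Real.exp (C * N), by positivity, fun n s hs => ?_⟩, ?_⟩
  · dsimp only
    split_ifs with h
    · exact ⟨(hqd n h).le, hq0 n h,
        isRationalOfType_confluentRational σ (hqd n h).le (hq0 n h), fun _ => hqE n h⟩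
    · exact ⟨by simp, by simp, isRationalOfType_confluentRational σ (by simp) (by simp),
        fun h0 => absurd rfl h0⟩
  · dsimp only
    have hpos : 0 < Real.exp (-C * n) := Real.exp_pos _
    rw [add_mul, one_mul]
    split_ifs with h
    · exact (hq n h s hs).trans (le_add_of_nonneg_right (by positivity))
    · have h1 : 1 ≤ Real.exp (C * N) * Real.exp (-C * n) := by
        rw [← Real.exp_add]
        refine Real.one_le_exp ?_
        have : (n : ℝ) ≤ N := by exact_mod_cast (not_le.1 h).le
        nlinarith
      have h2 : ‖F s‖ ≤ |D| := (hD s hs).trans (le_abs_self D)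
      have h3 : confluentRational σ n 0 s = 0 := by simp [confluentRational]
      rw [h3, sub_zero, mul_assoc]
      nlinarith [abs_nonneg D]
  · filter_upwards [eventually_ge_atTop N] with n h
    simp only [if_pos h]
    exact ⟨hqd n h, hqE n h, hq n h⟩
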